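/- **Stratified Lie groups.** Let $n=N_1+\dots+N_r$ with $r\ge 1$, write $x=(x',x^{(2)},\dots,x^{(r)})\in\mathbb R^n=\mathbb R^{N_1}\times\cdots\times\mathbb R^{N_r}$, and put $N=N_1$. Let $\mathbb G=(\mathbb R^n,\cdot)$ be a stratified Lie group: $(\mathbb R^n,\cdot)$ is a Lie group for the standard smooth structure of $\mathbb R^n$; for every $\lambda>0$ the dilation $\delta_\lambda(x)=(\lambda x',\lambda^2x^{(2)},\dots,\lambda^r x^{(r)})$ is an automorphism of the group (so that its identity element is $0$); and if $X_1,\dots,X_N$ are the left invariant vector fields with $X_k(0)=\partial/\partial x'_k|_0$, then the Lie algebra of vector fields generated by $X_1,\dots,X_N$ has rank $n$ at every point $x\in\mathbb R^n$. Let $\nabla_H=(X_1,\dots,X_N)$ be the horizontal gradient, $|x'|=\sqrt{x_1'^2+\dots+x_N'^2}$, $x'\cdot\nabla_H f=\sum_{k=1}^N x'_k X_kf$, and let $dx$ be Lebesgue measure on $\mathbb R^n$ (which is a Haar measure of $\mathbb G$). **Theorem.** Let $1<p<\infty$ and $\alpha\in\mathbb R$. For $\xi,\eta\in\mathbb C$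 put $$C_p(\xi,\eta)=|\xi|^p-|\xi-\eta|^p-p\,|\xi-\eta|^{p-2}\operatorname{Re}\big((\xi-\eta)\,\overline{\eta}\big),$$ where the last term is read as $0$ if $\xi=\eta$. Then $C_p(\xi,\eta)\ge 0$ for all $\xi,\eta\in\mathbb C$. Moreover, for every complex-valued $f\in C_0^\infty(\mathbb G\setminus\{x'=0\})$ the functions $\frac{f}{|x'|^{\alpha/p}}$ and $\frac{x'\cdot\nabla_Hf}{|x'|^{\alpha/p}}$ belong to $L^p(\mathbb G)$, the integrand $C_p(\dots)$ below is integrable, and $$\left|\frac{N-\alpha}{p}\right|^p\left\|\frac{f}{|x'|^{\alpha/p}}\right\|_{L^p(\mathbb G)}^p=\left\|\frac{x'\cdot\nabla_Hf}{|x'|^{\alpha/p}}\right\|_{L^p(\mathbb G)}^p-\int_{\mathbb G}C_p\left(\frac{x'\cdot\nabla_Hf}{|x'|^{\alpha/p}},\ \frac{x'\cdot\nabla_Hf}{|x'|^{\alpha/p}}+\frac{N-\alpha}{p}\,\frac{f}{|x'|^{\alpha/p}}\right)dx .$$ -/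

import Mathlib

open scoped Manifold ContDiff

noncomputable section

namespace StratifiedHardy

/-- The underlying space `ℝⁿ = ℝ^{N₁} × ⋯ × ℝ^{N_r}` of a stratified group, where `r = s + 1` and
`d k = N_{k+1}`; the coordinate `⟨k, j⟩` is the `j`-th coordinate of the `(k+1)`-st stratum. -/
abbrev StratSpace {s : ℕ} (d : Fin (s + 1) → ℕ) : Type :=
  EuclideanSpace ℝ (Σ k : Fin (s + 1), Fin (d k))

/-- The standard smooth structure of `ℝⁿ`, given by the single chart `id`. -/
instance {s : ℕ} (d : Fin (s + 1) → ℕ) : ChartedSpace (StratSpace d) (StratSpace d) :=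
  chartedSpaceSelf (StratSpace d)

/-- The dilation `δ_lam (x', x⁽²⁾, …, x⁽ʳ⁾) = (lam x', lam² x⁽²⁾, …, lamʳ x⁽ʳ⁾)`. -/
def dilation {s : ℕ} {d : Fin (s + 1) → ℕ} (lam : ℝ) (x : StratSpace d) : StratSpace d :=
  WithLp.toLp 2 fun i => lam ^ ((i.1 : ℕ) + 1) * x i

/-- The variables `x'` from the first stratum; the norm of `firstStratum x` is the Euclidean norm
`|x'| = √(x₁'² + ⋯ + x_N'²)`. -/
def firstStratum {s : ℕ} {d : Fin (s + 1) → ℕ} (x : StratSpace d) :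
    EuclideanSpace ℝ (Fin (d 0)) :=
  WithLp.toLp 2 fun j => x ⟨0, j⟩

/-- The generator `X_k`, `k = 1, …, N`: the left invariant vector field whose value at the identity
of the group (which is the origin, see `one_eq_zero`) is `∂ / ∂x'_k`. -/
def generator {s : ℕ} (d : Fin (s + 1) → ℕ) [Group (StratSpace d)] (k : Fin (d 0)) :
    StratSpace d → StratSpace d := fun x =>
  mulInvariantVectorField (I := 𝓘(ℝ, StratSpace d)) (G := StratSpace d)
    (EuclideanSpace.single (⟨0, k⟩ : Σ k : Fin (s + 1), Fin (d k)) (1 : ℝ)) x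

/-- Membership in `Lie {X_k}`, the smallest real vector space of vector fields on `E` that contains
all the `X_k` and is closed under the Lie bracket of vector fields. -/
inductive InGeneratedLie {E : Type*} [NormedAddCommGroup E] [NormedSpace ℝ E] {ι : Type*}
    (X : ι → E → E) : (E → E) → Prop
  | of (k : ι) : InGeneratedLie X (X k)
  | zero : InGeneratedLie X 0
  | add {V W : E → E} : InGeneratedLie X V → InGeneratedLie X W → InGeneratedLie X (V + W)
  | smul (c : ℝ) {V : E → E} : InGeneratedLie X V → InGeneratedLie X (c • V)
  | bracket {V W : E → E} : InGeneratedLie X V → InGeneratedLie X W →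
      InGeneratedLie X (VectorField.lieBracket ℝ V W)

/-- A group law on `ℝ^{N₁} × ⋯ × ℝ^{N_r}` makes it a stratified Lie group if it is a Lie group for
the standard smooth structure of `ℝⁿ`, the dilations `δ_lam`, `lam > 0`, are automorphisms (they
are invertible linear maps in any case), and `rank Lie {X₁, …, X_N} = n` at every point. -/
class StratifiedLieGroup {s : ℕ} (d : Fin (s + 1) → ℕ) [Group (StratSpace d)] : Prop
    extends LieGroup 𝓘(ℝ, StratSpace d) ∞ (StratSpace d) where
  dilation_mul : ∀ lam : ℝ, 0 < lam → ∀ x y : StratSpace d,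
    dilation lam (x * y) = dilation lam x * dilation lam y
  rank_lie : ∀ x : StratSpace d,
    Module.finrank ℝ (Submodule.span ℝ {v | ∃ V, InGeneratedLie (generator d) V ∧ V x = v}) =
      ∑ k, d k

/-- The horizontal gradient `∇_H f = (X₁ f, …, X_N f)`. -/
def horizontalGradient {s : ℕ} {d : Fin (s + 1) → ℕ} [Group (StratSpace d)]
    (f : StratSpace d → ℂ) (x : StratSpace d) : Fin (d 0) → ℂ :=
  fun k => fderiv ℝ f x (generator d k x)

/-- `(x' · ∇_H) f = ∑ₖ x'_k X_k f`. -/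
def radialHorizontal {s : ℕ} {d : Fin (s + 1) → ℕ} [Group (StratSpace d)]
    (f : StratSpace d → ℂ) (x : StratSpace d) : ℂ :=
  ∑ k, (firstStratum x k : ℂ) * horizontalGradient f x k

/-- The functional `C_p(ξ, η) = |ξ|^p - |ξ - η|^p - p |ξ - η|^{p-2} Re ((ξ - η) · conj η)`
(the last term is zero for `ξ = η`). -/
def Cp (p : ℝ) (ξ η : ℂ) : ℝ :=
  ‖ξ‖ ^ p - ‖ξ - η‖ ^ p
    - p * ‖ξ - η‖ ^ (p - 2) * ((ξ - η) * (starRingEnd ℂ) η).re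

/-- `f / |x'|^{α/p}`. -/
def weighted {s : ℕ} {d : Fin (s + 1) → ℕ} (α p : ℝ) (f : StratSpace d → ℂ)
    (x : StratSpace d) : ℂ :=
  f x / ((‖firstStratum x‖ ^ (α / p) : ℝ) : ℂ)

/-- The identity element of the group is the origin. -/
theorem one_eq_zero {s : ℕ} (d : Fin (s + 1) → ℕ) [Group (StratSpace d)]
    [StratifiedLieGroup d] : (1 : StratSpace d) = 0 := by
  have h := StratifiedLieGroup.dilation_mul (d := d) 2 (by norm_num) 1 1
  rw [mul_one] at h
  have h1 : dilation 2 (1 : StratSpace d) = 1 := (left_eq_mul.mp h)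
  ext i
  have h2 : (2 : ℝ) ^ ((i.1 : ℕ) + 1) * (1 : StratSpace d) i = (1 : StratSpace d) i :=
    congrArg (fun v : StratSpace d => v i) h1
  have h3 : (2 : ℝ) ≤ 2 ^ ((i.1 : ℕ) + 1) := by
    simpa using pow_le_pow_right₀ (by norm_num : (1 : ℝ) ≤ 2) (Nat.le_add_left 1 (i.1 : ℕ))
  have h4 : ((2 : ℝ) ^ ((i.1 : ℕ) + 1) - 1) * (1 : StratSpace d) i = 0 := by linarith
  rcases mul_eq_zero.mp h4 with h5 | h5
  · linarith
  · simpa using h5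

end StratifiedHardy

end

namespace StratifiedHardy

open MeasureTheory Filter Topology

/-! ### Dilations and the first stratum -/

section Dilations

variable {s : ℕ} {d : Fin (s + 1) → ℕ}

/-! The theorem reduces to two facts about the field `R = ∑ x'_k X_k` (`radialField`): `div R = N`,
and `R` has first-stratum component `x'`. Both follow from homogeneity, without coordinate formulas
for the group law. Since dilations are automorphisms, `R` commutes with them
(`radialField_dilation`). The diagonal entries of its Jacobian are therefore dilation invariant and
continuous, hence equal to their values at `0`, where the Jacobian is the projection onto the first
stratum, of trace `N`. The component statement follows by differentiating `R (δ_lam x)` at `lam =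
0`.

Consequently `R |x'|^a = a |x'|^a`, and integration by parts gives `∫ |x'|^{-α} R|f|^p = -(N - α) ∫
|x'|^{-α} |f|^p` (`integral_weight_mul_fderiv_radialField`). Expanding `C_p` (`Cp_add_mul`) with `c
= (N - α)/p` leaves `R|f|^p` as the only cross term, so integrating yields the identity.
Nonnegativity of `C_p` is Cauchy–Schwarz followed by Young. -/

@[simp]
theorem dilation_apply (lam : ℝ) (x : StratSpace d) (i : Σ k : Fin (s + 1), Fin (d k)) :
    dilation lam x i = lam ^ ((i.1 : ℕ) + 1) * x i := rfl

/-- The dilation as a continuous linear map. -/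
noncomputable def dilationCLM (d : Fin (s + 1) → ℕ) (lam : ℝ) : StratSpace d →L[ℝ] StratSpace d :=
  LinearMap.toContinuousLinearMap
    { toFun := dilation lam
      map_add' := fun x y => by ext i; simp [mul_add]
      map_smul' := fun c x => by ext i; simp; ring }

@[simp]
theorem dilationCLM_apply (lam : ℝ) (x : StratSpace d) :
    dilationCLM d lam x = dilation lam x := rfl

theorem dilation_zero_left (x : StratSpace d) : dilation 0 x = 0 := by
  ext i; simp

theorem dilation_single (lam : ℝ) (i : Σ k : Fin (s + 1), Fin (d k)) :
    dilation lam (EuclideanSpace.single i (1 : ℝ)) =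
      lam ^ ((i.1 : ℕ) + 1) • EuclideanSpace.single i (1 : ℝ) := by
  ext j
  by_cases h : j = i
  · subst h; simp
  · simp [h]

/-- The projection onto the first stratum. -/
noncomputable def firstStratumCLM (d : Fin (s + 1) → ℕ) :
    StratSpace d →L[ℝ] EuclideanSpace ℝ (Fin (d 0)) :=
  LinearMap.toContinuousLinearMap
    { toFun := firstStratum
      map_add' := fun x y => by ext i; simp [firstStratum]
      map_smul' := fun c x => by ext i; simp [firstStratum] }

@[simp]
theorem firstStratumCLM_apply (x : StratSpace d) : firstStratumCLM d x = firstStratum x := rfl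

theorem contDiff_firstStratum_apply (k : Fin (d 0)) :
    ContDiff ℝ 1 fun x : StratSpace d => firstStratum x k :=
  ((EuclideanSpace.proj (𝕜 := ℝ) k).comp (firstStratumCLM d)).contDiff

/-- Only the first stratum scales linearly in `lam`; the higher ones carry powers at least two,
whose derivative vanishes at `0`. -/
theorem hasDerivAt_dilation (x : StratSpace d) :
    HasDerivAt (fun lam : ℝ => dilation lam x)
      (∑ k, firstStratum x k • EuclideanSpace.single (⟨0, k⟩ : Σ k : Fin (s + 1), Fin (d k)) (1 : ℝ))
      0 := by
  rw [hasDerivAt_iff_hasFDerivAt, ← hasFDerivWithinAt_univ, hasFDerivWithinAt_euclidean]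
  rintro ⟨k, j⟩
  rw [hasFDerivWithinAt_univ]
  have h : HasDerivAt (fun lam : ℝ => lam ^ ((k : ℕ) + 1) * x ⟨k, j⟩)
      ((((k : ℕ) + 1 : ℕ) : ℝ) * (0 : ℝ) ^ (k : ℕ) * x ⟨k, j⟩) 0 :=
    (hasDerivAt_pow ((k : ℕ) + 1) (0 : ℝ)).mul_const _
  refine h.hasFDerivAt.congr_fderiv ?_
  ext
  by_cases hk : k = 0
  · subst hk
    simp [firstStratum]
  · have : (k : ℕ) ≠ 0 := fun h => hk (Fin.ext h)
    simp [this, hk, Sigma.mk.injEq]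

theorem continuous_dilation_left (x : StratSpace d) :
    Continuous fun lam : ℝ => dilation lam x := by
  refine (PiLp.continuous_toLp 2 _).comp (continuous_pi fun i => ?_)
  fun_prop

/-- A continuous function that is invariant under the dilations is constant. -/
theorem eq_apply_zero_of_dilation_invariant {F : Type*} [TopologicalSpace F] [T2Space F]
    {g : StratSpace d → F} (hg : ContinuousAt g 0)
    (h : ∀ lam : ℝ, 0 < lam → ∀ x, g (dilation lam x) = g x) (x : StratSpace d) :
    g x = g 0 := by
  have h1 : Tendsto (fun lam : ℝ => g (dilation lam x)) (𝓝[>] 0) (𝓝 (g 0)) := by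
    have h2 : ContinuousAt g (dilation 0 x) := by rwa [dilation_zero_left]
    have h3 := (h2.comp (f := fun lam : ℝ => dilation lam x)
      (continuous_dilation_left x).continuousAt).tendsto
    simp only [Function.comp_def, dilation_zero_left] at h3
    exact h3.mono_left nhdsWithin_le_nhds
  have h4 : Tendsto (fun lam : ℝ => g (dilation lam x)) (𝓝[>] 0) (𝓝 (g x)) :=
    tendsto_const_nhds.congr' (by
      filter_upwards [self_mem_nhdsWithin] with lam hlam using (h lam hlam x).symm)
  exact tendsto_nhds_unique h4 h1

end Dilations

/-! ### Smoothness and homogeneity of the generators -/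

section Generators

variable {s : ℕ} {d : Fin (s + 1) → ℕ} [Group (StratSpace d)] [StratifiedLieGroup d]

theorem contDiff_mul : ContDiff ℝ ∞ (fun z : StratSpace d × StratSpace d => z.1 * z.2) := by
  have h := _root_.contMDiff_mul 𝓘(ℝ, StratSpace d) ∞ (G := StratSpace d)
  rw [← contMDiff_iff_contDiff, modelWithCornersSelf_prod, ← chartedSpaceSelf_prod]
  exact h

theorem generator_eq_fderiv (k : Fin (d 0)) (x : StratSpace d) :
    generator d k x = fderiv ℝ (fun y : StratSpace d => x * y) 0
      (EuclideanSpace.single ⟨0, k⟩ 1) := by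
  unfold generator mulInvariantVectorField
  rw [mfderiv_eq_fderiv, one_eq_zero d]
  rfl

theorem contDiff_generator (k : Fin (d 0)) : ContDiff ℝ 1 (generator d k) := by
  have h : ContDiff ℝ 1 fun x : StratSpace d => fderiv ℝ (fun y : StratSpace d => x * y) 0 :=
    ContDiff.fderiv (m := ∞) (f := fun x y : StratSpace d => x * y) (g := fun _ => 0)
      contDiff_mul contDiff_const (by norm_cast)
  have : generator d k = fun x => fderiv ℝ (fun y : StratSpace d => x * y) 0
      (EuclideanSpace.single ⟨0, k⟩ 1) := funext (generator_eq_fderiv k)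
  rw [this]
  exact h.clm_apply contDiff_const

theorem generator_zero (k : Fin (d 0)) :
    generator d k 0 = EuclideanSpace.single ⟨0, k⟩ 1 := by
  rw [generator_eq_fderiv]
  have : (fun y : StratSpace d => (0 : StratSpace d) * y) = id := by
    funext y
    rw [← one_eq_zero d, one_mul, id]
  rw [this, fderiv_id]
  rfl

theorem differentiable_mul_left (x : StratSpace d) :
    Differentiable ℝ fun y : StratSpace d => x * y :=
  ((contDiff_mul (d := d)).comp (contDiff_prodMk_right x)).differentiable (by simp)

/-- The generators are homogeneous of degree one with respect to the dilations. -/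
theorem smul_generator_dilation (k : Fin (d 0)) {lam : ℝ} (hlam : 0 < lam) (x : StratSpace d) :
    lam • generator d k (dilation lam x) = dilation lam (generator d k x) := by
  -- Differentiate both sides of `δ(x * y) = δx * δy` in `y` at the identity and evaluate on
  -- `∂/∂x'_k`, which `δ` scales by `lam`.
  have h1 : HasFDerivAt (fun y : StratSpace d => dilation lam x * dilation lam y)
      ((fderiv ℝ (fun y : StratSpace d => dilation lam x * y) 0).comp (dilationCLM d lam)) 0 := by
    have h := (differentiable_mul_left (dilation lam x) (dilationCLM d lam 0)).hasFDerivAt.comp 0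
      (dilationCLM d lam).hasFDerivAt
    rw [map_zero] at h
    exact h
  have h2 : HasFDerivAt (fun y : StratSpace d => dilation lam (x * y))
      ((dilationCLM d lam).comp (fderiv ℝ (fun y : StratSpace d => x * y) 0)) 0 :=
    (dilationCLM d lam).hasFDerivAt.comp 0 (differentiable_mul_left x 0).hasFDerivAt
  have h3 : (fun y : StratSpace d => dilation lam (x * y)) =
      fun y => dilation lam x * dilation lam y :=
    funext fun y => StratifiedLieGroup.dilation_mul lam hlam x y
  rw [h3] at h2
  have h4 := congrArg (fun T : StratSpace d →L[ℝ] StratSpace d =>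
    T (EuclideanSpace.single ⟨0, k⟩ 1)) (h1.unique h2)
  simp only [ContinuousLinearMap.comp_apply, dilationCLM_apply, dilation_single,
    ← generator_eq_fderiv] at h4
  rw [map_smul, ← generator_eq_fderiv] at h4
  simpa using h4

end Generators

/-! ### The radial field: equivariance, divergence, horizontal part -/

section RadialField

variable {s : ℕ} (d : Fin (s + 1) → ℕ) [Group (StratSpace d)]

/-- The vector field `x' · ∇_H = ∑ₖ x'_k X_k`. -/
noncomputable def radialField (x : StratSpace d) : StratSpace d :=
  ∑ k, firstStratum x k • generator d k x

variable {d}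

theorem radialHorizontal_eq_fderiv (f : StratSpace d → ℂ) (x : StratSpace d) :
    radialHorizontal f x = fderiv ℝ f x (radialField d x) := by
  simp [radialHorizontal, horizontalGradient, radialField, map_sum, map_smul]

theorem radialField_zero : radialField d 0 = 0 := by
  simp [radialField, firstStratum]

variable [StratifiedLieGroup d]

theorem contDiff_radialField : ContDiff ℝ 1 (radialField d) :=
  ContDiff.sum fun k _ => (contDiff_firstStratum_apply k).smul (contDiff_generator k)

theorem radialField_dilation {lam : ℝ} (hlam : 0 < lam) (x : StratSpace d) :
    radialField d (dilation lam x) = dilation lam (radialField d x) := by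
  rw [← dilationCLM_apply lam (radialField d x)]
  simp only [radialField, map_sum, map_smul, dilationCLM_apply, ← smul_generator_dilation _ hlam,
    smul_smul]
  refine Finset.sum_congr rfl fun k _ => ?_
  congr 1
  simp [firstStratum, mul_comm]

/-- The coefficients `x'_k` vanish at `0`, so the product rule never sees the derivatives of the
generators. -/
theorem fderiv_radialField_zero (v : StratSpace d) :
    fderiv ℝ (radialField d) 0 v = ∑ k, firstStratum v k • EuclideanSpace.single ⟨0, k⟩ 1 := by
  have h (k : Fin (d 0)) : HasFDerivAt (fun x : StratSpace d => firstStratum x k • generator d k x)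
      ((((EuclideanSpace.proj (𝕜 := ℝ) k).comp (firstStratumCLM d))).smulRight
        (EuclideanSpace.single ⟨0, k⟩ 1)) 0 := by
    have h1 := ((EuclideanSpace.proj (𝕜 := ℝ) k).comp (firstStratumCLM d)).hasFDerivAt
      (x := (0 : StratSpace d))
    have h2 := ((contDiff_generator k).differentiable one_ne_zero
      (0 : StratSpace d)).hasFDerivAt
    refine (h1.smul h2).congr_fderiv ?_
    ext1 w
    simp [generator_zero, firstStratum]
  have h3 : HasFDerivAt (radialField d) _ 0 := HasFDerivAt.fun_sum (u := Finset.univ) fun k _ => h k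
  rw [h3.fderiv]
  simp

/-- The diagonal entries of the Jacobian of the radial field are constant. -/
theorem fderiv_radialField_single_apply (x : StratSpace d) (i : Σ k : Fin (s + 1), Fin (d k)) :
    fderiv ℝ (radialField d) x (EuclideanSpace.single i 1) i =
      ∑ k, firstStratum (EuclideanSpace.single i (1 : ℝ) : StratSpace d) k *
        (EuclideanSpace.single ⟨0, k⟩ (1 : ℝ) : StratSpace d) i := by
  have hdiff : Differentiable ℝ (radialField d) := contDiff_radialField.differentiable one_ne_zero
  -- Differentiating the equivariance of `R` puts the same power of `lam` on both sides of a
  -- diagonal entry, so it cancels.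
  have hinv : ∀ lam : ℝ, 0 < lam → ∀ x : StratSpace d,
      fderiv ℝ (radialField d) (dilation lam x) (EuclideanSpace.single i 1) i =
        fderiv ℝ (radialField d) x (EuclideanSpace.single i 1) i := by
    intro lam hlam x
    have h1 : HasFDerivAt (fun y : StratSpace d => radialField d (dilation lam y))
        ((fderiv ℝ (radialField d) (dilation lam x)).comp (dilationCLM d lam)) x :=
      (hdiff (dilationCLM d lam x)).hasFDerivAt.comp x (dilationCLM d lam).hasFDerivAt
    have h2 : HasFDerivAt (fun y : StratSpace d => dilation lam (radialField d y))
        ((dilationCLM d lam).comp (fderiv ℝ (radialField d) x)) x :=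
      (dilationCLM d lam).hasFDerivAt.comp x (hdiff x).hasFDerivAt
    rw [← funext fun y => radialField_dilation hlam y] at h2
    have h4 := congrArg (fun T : StratSpace d →L[ℝ] StratSpace d =>
      T (EuclideanSpace.single i 1) i) (h1.unique h2)
    simp only [ContinuousLinearMap.comp_apply, dilationCLM_apply, dilation_single, map_smul,
      dilation_apply, PiLp.smul_apply, smul_eq_mul] at h4
    exact mul_left_cancel₀ (pow_pos hlam _).ne' h4
  have hcont : Continuous fun x : StratSpace d =>
      fderiv ℝ (radialField d) x (EuclideanSpace.single i 1) i :=
    (EuclideanSpace.proj (𝕜 := ℝ) i).continuous.comp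
      ((contDiff_radialField.continuous_fderiv one_ne_zero).clm_apply continuous_const)
  rw [eq_apply_zero_of_dilation_invariant hcont.continuousAt hinv x, fderiv_radialField_zero]
  simp only [WithLp.ofLp_sum, WithLp.ofLp_smul, Finset.sum_apply, Pi.smul_apply, smul_eq_mul]

theorem sum_fderiv_radialField_single_apply (x : StratSpace d) :
    ∑ i, fderiv ℝ (radialField d) x (EuclideanSpace.single i 1) i = d 0 := by
  simp_rw [fderiv_radialField_single_apply]
  rw [Finset.sum_comm]
  simp [firstStratum, mul_ite]

/-- The horizontal components of the radial field at `x` are those of `x`. -/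
theorem firstStratum_radialField (x : StratSpace d) :
    firstStratum (radialField d x) = firstStratum x := by
  have hdiff : Differentiable ℝ (radialField d) := contDiff_radialField.differentiable one_ne_zero
  have h1 : HasDerivAt (fun lam : ℝ => firstStratum (radialField d (dilation lam x)))
      (firstStratum x) 0 := by
    have h : HasFDerivAt (radialField d) (fderiv ℝ (radialField d) 0) (dilation 0 x) := by
      rw [dilation_zero_left]; exact (hdiff 0).hasFDerivAt
    have h' := (firstStratumCLM d).hasFDerivAt.comp_hasDerivAt (0 : ℝ)
      (h.comp_hasDerivAt (0 : ℝ) (hasDerivAt_dilation x))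
    refine h'.congr_deriv ?_
    rw [fderiv_radialField_zero]
    ext j
    simp [firstStratum, Pi.single_apply]
  have h2 : HasDerivAt (fun lam : ℝ => lam • firstStratum (radialField d x))
      (firstStratum (radialField d x)) 0 := by
    simpa using (hasDerivAt_id (0 : ℝ)).smul_const (firstStratum (radialField d x))
  -- Homogeneity is available only for `lam > 0`, so the two curves are compared through one-sided
  -- derivatives at `0`.
  refine UniqueDiffWithinAt.eq_deriv (Set.Ici 0) (uniqueDiffOn_Ici 0 0 Set.self_mem_Ici)
    h2.hasDerivWithinAt (h1.hasDerivWithinAt.congr ?_ ?_)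
  · intro lam hlam
    rcases (show (0 : ℝ) ≤ lam from hlam).eq_or_lt with rfl | hlam
    · rw [dilation_zero_left, radialField_zero]
      simp [← firstStratumCLM_apply]
    · rw [radialField_dilation hlam]
      ext j
      simp [firstStratum]
  · rw [dilation_zero_left, radialField_zero]
    simp [← firstStratumCLM_apply]

/-- The radial field has divergence `N`. -/
theorem integral_fderiv_radialField {u : StratSpace d → ℝ} (hu : ContDiff ℝ 1 u)
    (hc : HasCompactSupport u) :
    ∫ x, fderiv ℝ u x (radialField d x) = -((d 0 : ℝ) * ∫ x, u x) := by
  have hR (i) : ContDiff ℝ 1 fun x => radialField d x i :=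
    (EuclideanSpace.proj (𝕜 := ℝ) i).contDiff.comp contDiff_radialField
  have hRd (i) (x v : StratSpace d) :
      fderiv ℝ (fun x => radialField d x i) x v = fderiv ℝ (radialField d) x v i := by
    have := (EuclideanSpace.proj (𝕜 := ℝ) i).hasFDerivAt.comp x
      (contDiff_radialField.differentiable one_ne_zero x).hasFDerivAt
    exact congrArg (fun T : StratSpace d →L[ℝ] ℝ => T v) this.fderiv
  have hcu (v : StratSpace d) : HasCompactSupport fun x => fderiv ℝ u x v := hc.fderiv_apply ℝ v
  have hcont (v : StratSpace d) : Continuous fun x => fderiv ℝ u x v :=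
    (hu.continuous_fderiv one_ne_zero).clm_apply continuous_const
  have hint1 (i) : Integrable fun x => radialField d x i *
      fderiv ℝ u x (EuclideanSpace.single i 1) :=
    ((hR i).continuous.mul (hcont _)).integrable_of_hasCompactSupport (hcu _).mul_left
  have hint2 (i) : Integrable fun x => fderiv ℝ (fun x => radialField d x i) x
      (EuclideanSpace.single i 1) * u x :=
    ((((hR i).continuous_fderiv one_ne_zero).clm_apply continuous_const).mul
      hu.continuous).integrable_of_hasCompactSupport hc.mul_left
  -- Coordinatewise integration by parts involves only the diagonal Jacobian entries, the ones known
  -- to be constant.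
  have hparts (i) := integral_mul_fderiv_eq_neg_fderiv_mul_of_integrable (hint2 i) (hint1 i)
    (((hR i).continuous.mul hu.continuous).integrable_of_hasCompactSupport hc.mul_left)
    (fun x _ => (hR i).differentiable one_ne_zero x)
    (fun x _ => hu.differentiable one_ne_zero x)
  have hexp (x : StratSpace d) : fderiv ℝ u x (radialField d x) =
      ∑ i, radialField d x i * fderiv ℝ u x (EuclideanSpace.single i 1) := by
    conv_lhs => rw [← (EuclideanSpace.basisFun _ ℝ).sum_repr (radialField d x)]
    simp [map_sum]
  simp_rw [hexp]
  rw [integral_finsetSum _ fun i _ => hint1 i]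
  simp_rw [hparts]
  rw [Finset.sum_neg_distrib, ← integral_finsetSum _ fun i _ => hint2 i]
  simp_rw [← Finset.sum_mul, hRd, sum_fderiv_radialField_single_apply]
  rw [integral_const_mul]

end RadialField

/-! ### The functional `C_p` -/

/-- With `ζ = ξ - η`, bounding `Re (ζ conj ξ)` by `|ζ||ξ|` reduces the claim to Young's inequality
for `|ξ|` and `|ζ|^{p-1}`. -/
theorem Cp_nonneg {p : ℝ} (hp : 1 < p) (ξ η : ℂ) : 0 ≤ Cp p ξ η := by
  obtain ⟨ζ, rfl⟩ : ∃ ζ, η = ξ - ζ := ⟨ξ - η, by ring⟩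
  have hp0 : 0 < p := by linarith
  have hre : (ζ * (starRingEnd ℂ) (ξ - ζ)).re ≤ ‖ζ‖ * ‖ξ‖ - ‖ζ‖ ^ 2 := by
    have h1 : (ζ * (starRingEnd ℂ) ξ).re ≤ ‖ζ‖ * ‖ξ‖ := by
      simpa using Complex.re_le_norm (ζ * (starRingEnd ℂ) ξ)
    rw [map_sub, mul_sub, Complex.mul_conj]
    simp only [Complex.sub_re, Complex.ofReal_re, Complex.normSq_eq_norm_sq]
    linarith
  have hyoung : ‖ξ‖ * ‖ζ‖ ^ (p - 1) ≤ ‖ξ‖ ^ p / p + ‖ζ‖ ^ p * (p - 1) / p := by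
    have hq : p.HolderConjugate p.conjExponent := Real.HolderConjugate.conjExponent hp
    have h := Real.young_inequality_of_nonneg (norm_nonneg ξ)
      (Real.rpow_nonneg (norm_nonneg ζ) (p - 1)) hq
    rw [← Real.rpow_mul (norm_nonneg ζ)] at h
    have h1 : (p - 1) * p.conjExponent = p := by
      rw [Real.conjExponent]; field_simp [(by linarith : p - 1 ≠ 0)]
    rw [h1, Real.conjExponent, div_div_eq_mul_div] at h
    exact h
  have hyoung' : p * (‖ξ‖ * ‖ζ‖ ^ (p - 1)) ≤ ‖ξ‖ ^ p + ‖ζ‖ ^ p * (p - 1) := by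
    have h := mul_le_mul_of_nonneg_left hyoung hp0.le
    have h1 : p * (‖ξ‖ ^ p / p + ‖ζ‖ ^ p * (p - 1) / p) = ‖ξ‖ ^ p + ‖ζ‖ ^ p * (p - 1) := by
      field_simp
    linarith
  unfold Cp
  rw [show ξ - (ξ - ζ) = ζ by ring]
  rcases eq_or_ne ζ 0 with rfl | hζ
  · simp [Real.zero_rpow hp0.ne', Real.rpow_nonneg]
  have hpos : 0 < ‖ζ‖ := norm_pos_iff.mpr hζ
  have e1 : ‖ζ‖ ^ (p - 2) * ‖ζ‖ = ‖ζ‖ ^ (p - 1) := by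
    rw [← Real.rpow_add_one hpos.ne']; congr 1; ring
  have e2 : ‖ζ‖ ^ (p - 2) * ‖ζ‖ ^ 2 = ‖ζ‖ ^ p := by
    rw [← Real.rpow_natCast, ← Real.rpow_add hpos]; congr 1; push_cast; ring
  have h2 : p * ‖ζ‖ ^ (p - 2) * (ζ * (starRingEnd ℂ) (ξ - ζ)).re ≤
      p * ‖ζ‖ ^ (p - 2) * (‖ζ‖ * ‖ξ‖ - ‖ζ‖ ^ 2) :=
    mul_le_mul_of_nonneg_left hre (by positivity)
  have h3 : p * ‖ζ‖ ^ (p - 2) * (‖ζ‖ * ‖ξ‖ - ‖ζ‖ ^ 2) =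
      p * (‖ξ‖ * ‖ζ‖ ^ (p - 1)) - p * ‖ζ‖ ^ p := by
    rw [← e1, ← e2]; ring
  linarith

/-- The functional `C_p(ξ, ξ + cζ)`, expanded. -/
theorem Cp_add_mul {p : ℝ} (hp : 1 < p) (ξ ζ : ℂ) (c : ℝ) :
    Cp p ξ (ξ + c * ζ) = ‖ξ‖ ^ p + (p - 1) * |c| ^ p * ‖ζ‖ ^ p +
      c * |c| ^ (p - 2) * (p * ‖ζ‖ ^ (p - 2) * (ζ * (starRingEnd ℂ) ξ).re) := by
  have hp0 : 0 < p := by linarith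
  have e (t : ℝ) (ht : 0 ≤ t) : t ^ (p - 2) * t ^ 2 = t ^ p := by
    rcases ht.eq_or_lt with rfl | ht
    · simp [Real.zero_rpow hp0.ne']
    · rw [← Real.rpow_natCast, ← Real.rpow_add ht]; congr 1; push_cast; ring
  have h1 : ‖ξ - (ξ + c * ζ)‖ = |c| * ‖ζ‖ := by
    rw [sub_add_cancel_left, norm_neg, norm_mul, Complex.norm_real, Real.norm_eq_abs]
  have h2 : ((ξ - (ξ + c * ζ)) * (starRingEnd ℂ) (ξ + c * ζ)).re =
      -(c * (ζ * (starRingEnd ℂ) ξ).re) - |c| ^ 2 * ‖ζ‖ ^ 2 := by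
    rw [sq_abs, ← Complex.normSq_eq_norm_sq, Complex.normSq_apply]
    simp
    ring
  unfold Cp
  rw [h1, h2, Real.mul_rpow (abs_nonneg c) (norm_nonneg ζ),
    Real.mul_rpow (abs_nonneg c) (norm_nonneg ζ), ← e |c| (abs_nonneg c),
    ← e ‖ζ‖ (norm_nonneg ζ)]
  ring

/-! ### Powers of `|x'|` as weights -/

section Weights

variable {s : ℕ} {d : Fin (s + 1) → ℕ}

theorem contDiffAt_norm_firstStratum_rpow (a : ℝ) {x : StratSpace d} (hx : firstStratum x ≠ 0) :
    ContDiffAt ℝ 1 (fun y : StratSpace d => ‖firstStratum y‖ ^ a) x :=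
  ((firstStratumCLM d).contDiff.contDiffAt.norm ℝ hx).rpow_const_of_ne (norm_ne_zero_iff.mpr hx)

/-- A weight `|x'|^a` times a `C^n` function supported away from `x' = 0` is `C^n`. -/
theorem contDiff_norm_firstStratum_rpow_smul {F : Type*} [NormedAddCommGroup F] [NormedSpace ℝ F]
    {n : WithTop ℕ∞} (hn : n ≤ 1) (a : ℝ) {g : StratSpace d → F} (hg : ContDiff ℝ n g)
    (hs : tsupport g ⊆ {x | firstStratum x ≠ 0}) :
    ContDiff ℝ n fun x => ‖firstStratum x‖ ^ a • g x := by
  refine contDiff_iff_contDiffAt.mpr fun x => ?_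
  by_cases hx : x ∈ tsupport g
  · exact ((contDiffAt_norm_firstStratum_rpow a (hs hx)).of_le hn).smul hg.contDiffAt
  · refine (contDiffAt_const (c := (0 : F))).congr_of_eventuallyEq ?_
    filter_upwards [notMem_tsupport_iff_eventuallyEq.mp hx] with y hy
    rw [hy, Pi.zero_apply, smul_zero]

theorem weighted_eq_smul (α p : ℝ) (g : StratSpace d → ℂ) :
    weighted α p g = fun x => ‖firstStratum x‖ ^ (-(α / p)) • g x := by
  funext x
  rw [weighted, Real.rpow_neg (norm_nonneg _), Complex.real_smul, Complex.ofReal_inv,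
    div_eq_inv_mul]

theorem continuous_weighted (α p : ℝ) {g : StratSpace d → ℂ} (hg : Continuous g)
    (hs : tsupport g ⊆ {x | firstStratum x ≠ 0}) : Continuous (weighted α p g) := by
  rw [weighted_eq_smul]
  exact (contDiff_norm_firstStratum_rpow_smul zero_le_one _ (contDiff_zero.mpr hg) hs).continuous

theorem hasCompactSupport_weighted (α p : ℝ) {g : StratSpace d → ℂ} (hg : HasCompactSupport g) :
    HasCompactSupport (weighted α p g) := by
  refine hg.mono fun x hx h => hx ?_
  simp [weighted, h]

theorem norm_weighted_rpow {p : ℝ} (hp : p ≠ 0) (α : ℝ) (g : StratSpace d → ℂ)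
    (x : StratSpace d) : ‖weighted α p g x‖ ^ p = ‖firstStratum x‖ ^ (-α) * ‖g x‖ ^ p := by
  rw [weighted_eq_smul, norm_smul, Real.norm_of_nonneg (by positivity),
    Real.mul_rpow (by positivity) (norm_nonneg _), ← Real.rpow_mul (norm_nonneg _)]
  congr 2
  field_simp

theorem tsupport_norm_rpow_subset {p : ℝ} (hp : p ≠ 0) (f : StratSpace d → ℂ) :
    tsupport (fun x => ‖f x‖ ^ p) ⊆ tsupport f := by
  refine closure_mono fun x hx h => hx ?_
  simp [h, Real.zero_rpow hp]

end Weights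

/-! ### Weighted integration by parts along the radial field -/

section Hardy

variable {s : ℕ} {d : Fin (s + 1) → ℕ} [Group (StratSpace d)]

theorem tsupport_radialHorizontal_subset (f : StratSpace d → ℂ) :
    tsupport (radialHorizontal f) ⊆ tsupport f := by
  refine closure_minimal (fun x hx => ?_) (isClosed_tsupport f)
  refine support_fderiv_subset ℝ fun h : fderiv ℝ f x = 0 => hx ?_
  rw [radialHorizontal_eq_fderiv, h, zero_apply]

theorem fderiv_norm_rpow_radialField {p : ℝ} (hp : 1 < p) {f : StratSpace d → ℂ}
    (hf : Differentiable ℝ f) (x : StratSpace d) :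
    fderiv ℝ (fun y => ‖f y‖ ^ p) x (radialField d x) =
      p * ‖f x‖ ^ (p - 2) * (f x * (starRingEnd ℂ) (radialHorizontal f x)).re := by
  rw [hf.fderiv_norm_rpow hp, radialHorizontal_eq_fderiv]
  simp [Complex.inner]
  left
  ring

/-- The derivative of `|f|^p` along the radial field, against the weight. -/
theorem weighted_mul_conj_re {p : ℝ} (hp : 1 < p) (α : ℝ) {f : StratSpace d → ℂ}
    (hf : Differentiable ℝ f) {x : StratSpace d} (hx : firstStratum x ≠ 0) :
    p * ‖weighted α p f x‖ ^ (p - 2) *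
        (weighted α p f x * (starRingEnd ℂ) (weighted α p (radialHorizontal f) x)).re =
      ‖firstStratum x‖ ^ (-α) * fderiv ℝ (fun y => ‖f y‖ ^ p) x (radialField d x) := by
  have hpos : 0 < ‖firstStratum x‖ := norm_pos_iff.mpr hx
  rw [fderiv_norm_rpow_radialField hp hf, weighted_eq_smul, weighted_eq_smul]
  set w := ‖firstStratum x‖ ^ (-(α / p)) with hw
  have hw0 : 0 < w := Real.rpow_pos_of_pos hpos _
  have h1 : w ^ (p - 2) * w ^ 2 = ‖firstStratum x‖ ^ (-α) := by
    rw [← Real.rpow_natCast, ← Real.rpow_add hw0, hw, ← Real.rpow_mul (norm_nonneg _)]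
    congr 1
    push_cast
    field_simp
    ring
  have h2 : (w • f x * (starRingEnd ℂ) (w • radialHorizontal f x)).re =
      w ^ 2 * (f x * (starRingEnd ℂ) (radialHorizontal f x)).re := by
    simp
    ring
  rw [← h1, h2, norm_smul, Real.norm_of_nonneg hw0.le, Real.mul_rpow hw0.le (norm_nonneg _)]
  ring

variable [StratifiedLieGroup d]

theorem continuous_radialHorizontal {f : StratSpace d → ℂ} (hf : ContDiff ℝ 1 f) :
    Continuous (radialHorizontal f) := by
  rw [funext (radialHorizontal_eq_fderiv f)]
  exact (hf.continuous_fderiv one_ne_zero).clm_apply contDiff_radialField.continuous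

/-- Euler's identity for the horizontal homogeneous weights. -/
theorem fderiv_norm_firstStratum_rpow_radialField (a : ℝ) {x : StratSpace d}
    (hx : firstStratum x ≠ 0) :
    fderiv ℝ (fun y : StratSpace d => ‖firstStratum y‖ ^ a) x (radialField d x) =
      a * ‖firstStratum x‖ ^ a := by
  have hpos : 0 < ‖firstStratum x‖ := norm_pos_iff.mpr hx
  -- Going through `|x'|²` makes the derivative along `R` equal to `2⟨x', x'⟩`, because `R` has
  -- horizontal part `x'`.
  have h1 : HasFDerivAt (fun y : StratSpace d => ‖firstStratum y‖ ^ 2)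
      ((2 • innerSL ℝ (firstStratum x)).comp (firstStratumCLM d)) x :=
    (hasStrictFDerivAt_norm_sq (firstStratum x)).hasFDerivAt.comp x
      (firstStratumCLM d).hasFDerivAt
  have h2 := h1.rpow_const (p := a / 2) (Or.inl (by positivity))
  have h3 (y : StratSpace d) : (‖firstStratum y‖ ^ 2) ^ (a / 2) = ‖firstStratum y‖ ^ a := by
    rw [← Real.rpow_natCast, ← Real.rpow_mul (norm_nonneg _)]
    congr 1
    push_cast
    ring
  simp_rw [h3] at h2
  rw [h2.fderiv]
  have h4 : (‖firstStratum x‖ ^ 2) ^ (a / 2 - 1) * ‖firstStratum x‖ ^ 2 =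
      ‖firstStratum x‖ ^ a := by
    rw [← Real.rpow_add_one (by positivity), sub_add_cancel, h3]
  simp only [smul_apply, ContinuousLinearMap.comp_apply,
    firstStratumCLM_apply, firstStratum_radialField, innerSL_apply_apply,
    real_inner_self_eq_norm_sq, nsmul_eq_mul, smul_eq_mul]
  rw [← h4]
  push_cast
  ring

/-- Integration by parts along the radial field with the weight `|x'|^{-α}`. -/
theorem integral_weight_mul_fderiv_radialField (α : ℝ) {v : StratSpace d → ℝ}
    (hv : ContDiff ℝ 1 v) (hc : HasCompactSupport v)
    (hs : tsupport v ⊆ {x | firstStratum x ≠ 0}) :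
    Integrable (fun x => ‖firstStratum x‖ ^ (-α) * fderiv ℝ v x (radialField d x)) ∧
    ∫ x, ‖firstStratum x‖ ^ (-α) * fderiv ℝ v x (radialField d x) =
      -(((d 0 : ℝ) - α) * ∫ x, ‖firstStratum x‖ ^ (-α) * v x) := by
  set u : StratSpace d → ℝ := fun x => ‖firstStratum x‖ ^ (-α) * v x with hu_def
  have hu : ContDiff ℝ 1 u := contDiff_norm_firstStratum_rpow_smul le_rfl (-α) hv hs
  have huc : HasCompactSupport u := hc.mul_left
  -- Product rule and Euler's identity; off the support of `v` every term is zero, so the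
  -- singularity of the weight is harmless.
  have hD (x : StratSpace d) : ‖firstStratum x‖ ^ (-α) * fderiv ℝ v x (radialField d x) =
      fderiv ℝ u x (radialField d x) + α * u x := by
    by_cases hx : x ∈ tsupport v
    · have h := ((contDiffAt_norm_firstStratum_rpow (-α) (hs hx)).differentiableAt
        one_ne_zero).hasFDerivAt.mul (hv.differentiable one_ne_zero x).hasFDerivAt
      rw [show fderiv ℝ u x = _ from h.fderiv]
      simp only [add_apply, smul_apply, smul_eq_mul,
        fderiv_norm_firstStratum_rpow_radialField (-α) (hs hx), hu_def]
      ring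
    · have hx' : x ∉ tsupport u := fun h => hx (tsupport_mul_subset_right h)
      rw [fderiv_of_notMem_tsupport ℝ hx, fderiv_of_notMem_tsupport ℝ hx',
        image_eq_zero_of_notMem_tsupport hx']
      simp
  have hi : Integrable u := hu.continuous.integrable_of_hasCompactSupport huc
  have hi' : Integrable fun x => fderiv ℝ u x (radialField d x) := by
    refine ((hu.continuous_fderiv one_ne_zero).clm_apply
      contDiff_radialField.continuous).integrable_of_hasCompactSupport ?_
    refine (huc.fderiv ℝ).mono fun x hx h => hx ?_
    simp [h]
  simp_rw [hD]
  refine ⟨hi'.add (hi.const_mul α), ?_⟩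
  rw [integral_add hi' (hi.const_mul α), integral_fderiv_radialField hu huc, integral_const_mul]
  ring

end Hardy

end StratifiedHardy

/-! ### The Hardy identity -/

open StratifiedHardy MeasureTheory in
theorem mainTheorem5 {s : ℕ} (d : Fin (s + 1) → ℕ) [Group (StratSpace d)] [StratifiedLieGroup d]
    (p α : ℝ) (hp : 1 < p) :
    (∀ ξ η : ℂ, 0 ≤ Cp p ξ η) ∧
    ∀ f : StratSpace d → ℂ, ContDiff ℝ ∞ f → HasCompactSupport f →
      tsupport f ⊆ {x | firstStratum x ≠ 0} →
      MemLp (weighted α p f) (ENNReal.ofReal p) volume ∧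
      MemLp (weighted α p (radialHorizontal f)) (ENNReal.ofReal p) volume ∧
      Integrable (fun x => Cp p (weighted α p (radialHorizontal f) x)
        (weighted α p (radialHorizontal f) x
          + (((d 0 : ℝ) - α) / p : ℝ) * weighted α p f x)) volume ∧
      |((d 0 : ℝ) - α) / p| ^ p * (eLpNorm (weighted α p f) (ENNReal.ofReal p) volume).toReal ^ p
        = (eLpNorm (weighted α p (radialHorizontal f)) (ENNReal.ofReal p) volume).toReal ^ p
          - ∫ x, Cp p (weighted α p (radialHorizontal f) x)
              (weighted α p (radialHorizontal f) x
                + (((d 0 : ℝ) - α) / p : ℝ) * weighted α p f x) := by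
  refine ⟨Cp_nonneg hp, fun f hf hc hs => ?_⟩
  have hp0 : 0 < p := by linarith
  have hf1 : ContDiff ℝ 1 f := hf.of_le (by norm_cast)
  have hsub := tsupport_radialHorizontal_subset f
  have hRc : HasCompactSupport (radialHorizontal f) :=
    hc.of_isClosed_subset (isClosed_tsupport _) hsub
  have hLp : MemLp (weighted α p f) (ENNReal.ofReal p) volume :=
    (continuous_weighted α p hf.continuous hs).memLp_of_hasCompactSupport
      (hasCompactSupport_weighted α p hc)
  have hLpR : MemLp (weighted α p (radialHorizontal f)) (ENNReal.ofReal p) volume :=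
    (continuous_weighted α p (continuous_radialHorizontal hf1)
      (hsub.trans hs)).memLp_of_hasCompactSupport (hasCompactSupport_weighted α p hRc)
  have hnorm {g : StratSpace d → ℂ} (hg : MemLp g (ENNReal.ofReal p) volume) :
      (eLpNorm g (ENNReal.ofReal p) volume).toReal ^ p = ∫ x, ‖g x‖ ^ p := by
    have hI : 0 ≤ ∫ x, ‖g x‖ ^ p := integral_nonneg fun x => by positivity
    rw [hg.eLpNorm_eq_integral_rpow_norm (by simpa using hp0) ENNReal.ofReal_ne_top,
      ENNReal.toReal_ofReal hp0.le, ENNReal.toReal_ofReal (by positivity),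
      ← Real.rpow_mul hI, inv_mul_cancel₀ hp0.ne', Real.rpow_one]
  have hint {g : StratSpace d → ℂ} (hg : MemLp g (ENNReal.ofReal p) volume) :
      Integrable fun x => ‖g x‖ ^ p := by
    simpa [ENNReal.toReal_ofReal hp0.le] using
      hg.integrable_norm_rpow (by simpa using hp0) ENNReal.ofReal_ne_top
  set c : ℝ := ((d 0 : ℝ) - α) / p with hc_def
  have hv : ContDiff ℝ 1 fun x => ‖f x‖ ^ p := hf1.norm_rpow hp
  have hvs := tsupport_norm_rpow_subset hp0.ne' f
  obtain ⟨hi, hparts⟩ := integral_weight_mul_fderiv_radialField α hv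
    (hc.of_isClosed_subset (isClosed_tsupport _) hvs) (hvs.trans hs)
  have hC (x : StratSpace d) : Cp p (weighted α p (radialHorizontal f) x)
      (weighted α p (radialHorizontal f) x + c * weighted α p f x) =
      ‖weighted α p (radialHorizontal f) x‖ ^ p
        + (p - 1) * |c| ^ p * ‖weighted α p f x‖ ^ p
        + c * |c| ^ (p - 2) * (‖firstStratum x‖ ^ (-α) *
            fderiv ℝ (fun y => ‖f y‖ ^ p) x (radialField d x)) := by
    rw [Cp_add_mul hp]
    congr 2
    by_cases hx : x ∈ tsupport f
    · exact weighted_mul_conj_re hp α (hf1.differentiable one_ne_zero) (hs hx)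
    · rw [fderiv_of_notMem_tsupport ℝ fun h => hx (hvs h)]
      simp [weighted, image_eq_zero_of_notMem_tsupport hx]
  simp_rw [hC]
  have hi1 := hint hLpR
  have hi2 := (hint hLp).const_mul ((p - 1) * |c| ^ p)
  have hi3 := hi.const_mul (c * |c| ^ (p - 2))
  refine ⟨hLp, hLpR, (hi1.add hi2).add hi3, ?_⟩
  rw [integral_add (by exact hi1.add hi2) hi3, integral_add hi1 hi2, integral_const_mul,
    integral_const_mul, hparts, hnorm hLp, hnorm hLpR]
  simp_rw [← norm_weighted_rpow hp0.ne' α f]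
  have hcp : (d 0 : ℝ) - α = p * c := by rw [hc_def]; field_simp
  -- The cross term integrates to `-p |c|^p` times the weighted norm, which combines with `(p - 1)
  -- |c|^p` to leave `-|c|^p`.
  have hcc : c * |c| ^ (p - 2) * c = |c| ^ p := by
    rcases eq_or_ne c 0 with h0 | h0
    · simp [h0, Real.zero_rpow hp0.ne']
    · have h1 : |c| ^ (p - 2) * |c| ^ 2 = |c| ^ p := by
        rw [← Real.rpow_natCast, ← Real.rpow_add (abs_pos.mpr h0)]
        congr 1
        push_cast
        ring
      rw [← h1, sq_abs]
      ring
  rw [hcp, ← hcc]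
  ring
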